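/- Let $[k]=\{1,2,\ldots,k\}$. A sequence $S=s_0s_1\cdots s_{M-1}$ with entries in $[k]$ is called cyclic $3$-distinguishable if the $M$ multisets $\{s_t,s_{t+1},s_{t+2}\}$, $0\le t<M$ (indices taken modulo $M$, multiplicities counted), are pairwise distinct. Theorem. For every positive integer $k$ divisible by $3$ there is a cyclic $3$-distinguishable sequence on $[k]$ of length $\binom{k+2}{3}-\frac{k}{3}$ such that the $3$-element multisets with elements in $[k]$ that do not occur among the multisets $\{s_t,s_{t+1},s_{t+2}\}$ are exactly the $k/3$ multisets $\{1,2,3\},\{4,5,6\},\ldots,\{k-2,k-1,k\}$. -/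

import Mathlib

/-- The multiset `{s_t, s_{t+1}, …, s_{t+m-1}}` tagged at position `t` of the sequence
`S = s_0 s_1 ⋯ s_{M-1}`, with indices taken modulo `M` and multiplicities counted. -/
def cyclicMultiset {α : Type*} {M : ℕ} (m : ℕ) (S : Fin M → α) (t : Fin M) : Multiset α :=
  (Multiset.range m).map fun i =>
    S ⟨((t : ℕ) + i) % M, Nat.mod_lt _ (Nat.lt_of_le_of_lt (Nat.zero_le _) t.isLt)⟩

/-- `S = s_0 s_1 ⋯ s_{M-1}` is cyclic `m`-distinguishable: the `M` multisets tagged at its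
positions are all distinct. -/
def IsCyclicDistinguishable {α : Type*} {M : ℕ} (m : ℕ) (S : Fin M → α) : Prop :=
  ∀ t t' : Fin M, cyclicMultiset m S t = cyclicMultiset m S t' → t = t'

/-! Split the letters into blocks of three and sort the three-element multisets other than the
blocks themselves by the set of blocks they meet. Up to renaming blocks, each class is a finite
problem: for one or two blocks a single closed list has the class as its windows (9 or 36 of them);
for three blocks, three closed lists of 9 windows each do. A closed list starts and ends with the
same ordered pair `(a, b)`, so it can be inserted wherever another list passes through `(a, b)`, and
the windows simply add up (`IsClosedAt.splice`).

All classes can be joined in this way. For `i < j`, the list of `{i, j}` is closed at `(3i+1,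
3i+1)`, which the list of `{i}` passes through; the list of `{0, j}` passes through `(3j+1, 3j+1)`,
where that of `{j}` is closed; and for `i < j < k` the three lists of `{i, j, k}` are closed at the
pairs `(3i+1, 3j+r+1)`, `r < 3`, found in the list of `{i, j}`. So everything grows from `{0}`.
Dropping the last two letters of the final list gives the cyclic sequence. -/

/-! ### Windows and consecutive pairs of a list -/

/-- The multisets of three consecutive entries of a list, in order. -/
def windows : List ℕ → List (Multiset ℕ)
  | a :: b :: c :: l => {a, b, c} :: windows (b :: c :: l)
  | _ => []

/-- The pairs of consecutive entries of a list, in order. -/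
def consecutivePairs : List ℕ → List (ℕ × ℕ)
  | a :: b :: l => (a, b) :: consecutivePairs (b :: l)
  | _ => []

theorem windows_append (u v : List ℕ) (a b : ℕ) :
    windows (u ++ a :: b :: v) = windows (u ++ [a, b]) ++ windows (a :: b :: v) := by
  induction u with
  | nil => simp [windows]
  | cons x u ih =>
    match u, ih with
    | [], _ => simp [windows]
    | [y], _ => simp [windows]
    | y :: z :: u, ih => simpa [windows] using ih

theorem consecutivePairs_append (u v : List ℕ) (a : ℕ) :
    consecutivePairs (u ++ a :: v) = consecutivePairs (u ++ [a]) ++ consecutivePairs (a :: v) := by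
  induction u with
  | nil => simp [consecutivePairs]
  | cons x u ih =>
    match u, ih with
    | [], _ => simp [consecutivePairs]
    | y :: u, ih => simpa [consecutivePairs] using ih

theorem exists_append_of_mem_consecutivePairs {l : List ℕ} {a b : ℕ}
    (h : (a, b) ∈ consecutivePairs l) : ∃ u v, l = u ++ a :: b :: v := by
  induction l with
  | nil => simp [consecutivePairs] at h
  | cons x l ih =>
    match l, ih, h with
    | [], _, h => simp [consecutivePairs] at h
    | y :: l, ih, h =>
      simp only [consecutivePairs, List.mem_cons, Prod.mk.injEq] at h
      rcases h with ⟨rfl, rfl⟩ | h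
      · exact ⟨[], l, rfl⟩
      · obtain ⟨u, v, huv⟩ := ih h
        exact ⟨x :: u, v, by rw [huv]; rfl⟩

theorem windows_map (f : ℕ → ℕ) (l : List ℕ) :
    windows (l.map f) = (windows l).map (Multiset.map f) := by
  induction l with
  | nil => simp [windows]
  | cons x l ih =>
    match l, ih with
    | [], _ => simp [windows]
    | [y], _ => simp [windows]
    | y :: z :: l, ih => simpa [windows] using ih

theorem consecutivePairs_map (f : ℕ → ℕ) (l : List ℕ) :
    consecutivePairs (l.map f) = (consecutivePairs l).map (Prod.map f f) := by
  induction l with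
  | nil => simp [consecutivePairs]
  | cons x l ih =>
    match l, ih with
    | [], _ => simp [consecutivePairs]
    | y :: l, ih => simpa [consecutivePairs] using ih

theorem windows_length (l : List ℕ) : (windows l).length = l.length - 2 := by
  induction l with
  | nil => simp [windows]
  | cons x l ih =>
    match l, ih with
    | [], _ => simp [windows]
    | [y], _ => simp [windows]
    | y :: z :: l, ih => simpa [windows] using ih

theorem windows_getElem (l : List ℕ) (t : ℕ) (h : t + 2 < l.length) :
    (windows l)[t]'(by rw [windows_length]; omega) = {l[t], l[t + 1], l[t + 2]} := by
  induction l generalizing t with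
  | nil => simp at h
  | cons x l ih =>
    match l, ih with
    | [], _ => simp at h
    | [y], _ => simp at h
    | y :: z :: l, ih =>
      cases t with
      | zero => simp [windows]
      | succ t => exact ih t (by simpa using h)

/-! ### Splicing closed lists -/

/-- A list that starts and ends with the two consecutive entries `p.1, p.2`. -/
def IsClosedAt (p : ℕ × ℕ) (l : List ℕ) : Prop :=
  [p.1, p.2] <+: l ∧ [p.1, p.2] <:+ l

/-- Write `l` as `u a b v` and `d` as `a b m` and as `m' a b`. Then `u d v` is both `u a b m v` and
`u m' a b v`, and no window straddles a cut that keeps the pair `a b` on both sides. -/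
theorem IsClosedAt.splice {p q : ℕ × ℕ} {l d : List ℕ} (hl : IsClosedAt p l)
    (hd : IsClosedAt q d) (hq : q ∈ consecutivePairs l) :
    ∃ l', IsClosedAt p l' ∧ (windows l').Perm (windows l ++ windows d) ∧
      (∀ r ∈ consecutivePairs l, r ∈ consecutivePairs l') ∧
      ∀ r ∈ consecutivePairs d, r ∈ consecutivePairs l' := by
  obtain ⟨a, b⟩ := q
  obtain ⟨u, v, rfl⟩ := exists_append_of_mem_consecutivePairs hq
  obtain ⟨⟨m, hm⟩, ⟨m', hm'⟩⟩ := hd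
  simp only at hm hm'
  have e1 : u ++ d ++ v = u ++ a :: b :: (m ++ v) := by simp [← hm]
  have e2 : u ++ d ++ v = (u ++ m') ++ a :: b :: v := by simp [← hm']
  refine ⟨u ++ d ++ v, ⟨?_, ?_⟩, ?_, ?_, ?_⟩
  · have h1 : [p.1, p.2] <+: u ++ [a, b] :=
      List.prefix_of_prefix_length_le hl.1 ⟨v, by simp⟩ (by simp)
    rw [e1]
    exact h1.trans ⟨m ++ v, by simp⟩
  · have h1 : [p.1, p.2] <:+ a :: b :: v :=
      List.suffix_of_suffix_length_le hl.2 ⟨u, by simp⟩ (by simp)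
    rw [e2]
    exact h1.trans ⟨u ++ m', by simp⟩
  · have e3 : (u ++ m') ++ [a, b] = u ++ a :: b :: m := by
      rw [List.append_assoc, hm', ← hm]; simp
    rw [e2, windows_append, e3, windows_append, windows_append u v]
    have : a :: b :: m = d := by rw [← hm]; simp
    rw [this, List.append_assoc, List.append_assoc]
    exact List.Perm.append_left _ List.perm_append_comm
  · intro r hr
    rw [consecutivePairs_append, List.mem_append] at hr
    rcases hr with hr | hr
    · rw [e1, consecutivePairs_append, List.mem_append]
      exact Or.inl hr
    · rw [e2, consecutivePairs_append, List.mem_append]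
      exact Or.inr hr
  · intro r hr
    have e4 : consecutivePairs (u ++ d ++ v) =
        consecutivePairs (u ++ [a]) ++ consecutivePairs (d ++ v) := by
      rw [e1, consecutivePairs_append]; simp [← hm]
    have e5 : consecutivePairs (d ++ v) = consecutivePairs d ++ consecutivePairs (b :: v) := by
      have h1 : d ++ v = (m' ++ [a]) ++ b :: v := by simp [← hm']
      have h2 : (m' ++ [a]) ++ [b] = d := by simp [← hm']
      rw [h1, consecutivePairs_append, h2]
    rw [e4, e5]
    simp [hr]

/-- Splicing destroys no consecutive pair, so the attachment points in `l` stay available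
throughout. -/
theorem IsClosedAt.splice_list {p : ℕ × ℕ} {l : List ℕ} (hl : IsClosedAt p l)
    (ds : List (List ℕ)) (hds : ∀ d ∈ ds, ∃ q ∈ consecutivePairs l, IsClosedAt q d) :
    ∃ l', IsClosedAt p l' ∧ (windows l').Perm (windows l ++ ds.flatMap windows) ∧
      (∀ r ∈ consecutivePairs l, r ∈ consecutivePairs l') ∧
      ∀ d ∈ ds, ∀ r ∈ consecutivePairs d, r ∈ consecutivePairs l' := by
  induction ds with
  | nil => exact ⟨l, hl, by simp, fun _ h => h, by simp⟩
  | cons d ds ih =>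
    obtain ⟨l₁, h1, h2, h3, h4⟩ := ih fun e he => hds e (by simp [he])
    obtain ⟨q, hq, hd⟩ := hds d (by simp)
    obtain ⟨l₂, k1, k2, k3, k4⟩ := h1.splice hd (h3 q hq)
    refine ⟨l₂, k1, ?_, fun r hr => k3 r (h3 r hr), ?_⟩
    · refine k2.trans ((h2.append_right _).trans ?_)
      rw [List.flatMap_cons, List.append_assoc]
      exact List.Perm.append_left _ List.perm_append_comm
    · intro e he r hr
      rcases List.mem_cons.1 he with rfl | he
      · exact k4 r hr
      · exact k3 r (h4 e he r hr)

/-! ### Blocks, classes of multisets and anchors -/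

/-- The index of the block `{3 i + 1, 3 i + 2, 3 i + 3}` that contains `a`. -/
def block (a : ℕ) : ℕ := (a - 1) / 3

/-- The set of blocks that a multiset meets. -/
def blocks (A : Multiset ℕ) : Finset ℕ := (A.map block).toFinset

/-- The three-element multisets of positive integers other than the blocks themselves. -/
def Admissible (A : Multiset ℕ) : Prop :=
  A.card = 3 ∧ (∀ a ∈ A, 1 ≤ a) ∧ ¬(A.Nodup ∧ (blocks A).card = 1)

/-- The pairs of letters at which closed lists over the blocks in `s` provide for splicing. -/
def IsAnchor (s : Finset ℕ) (p : ℕ × ℕ) : Prop :=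
  (s.card ≤ 2 ∧ ∃ i ∈ s, p = (3 * i + 1, 3 * i + 1)) ∨
    ∃ i j r, i < j ∧ r < 3 ∧ s = {i, j} ∧ p = (3 * i + 1, 3 * j + r + 1)

/-- Some closed list has as windows exactly the admissible multisets, once each, whose set of
blocks lies in `𝒮`, and it passes through the anchors of the members of `𝒮`. -/
def HasTour (𝒮 : Finset (Finset ℕ)) : Prop :=
  ∃ p l, IsClosedAt p l ∧ (windows l).Nodup ∧
    (∀ A, A ∈ windows l ↔ Admissible A ∧ blocks A ∈ 𝒮) ∧
    ∀ s ∈ 𝒮, ∀ q, IsAnchor s q → q ∈ consecutivePairs l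

/-- The lists `ds` have as windows exactly the admissible multisets, once each, whose set of
blocks is `s`, and they pass through the anchors of `s`. -/
def IsPiece (s : Finset ℕ) (ds : List (List ℕ)) : Prop :=
  (ds.flatMap windows).Nodup ∧
    (∀ A, A ∈ ds.flatMap windows ↔ Admissible A ∧ blocks A = s) ∧
    ∀ q, IsAnchor s q → ∃ d ∈ ds, q ∈ consecutivePairs d

/-- A multiset determines the blocks it meets, so windows of a new class cannot repeat old ones. -/
theorem HasTour.insert {𝒮 : Finset (Finset ℕ)} (h : HasTour 𝒮) {s : Finset ℕ} (hs : s ∉ 𝒮)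
    {ds : List (List ℕ)} (hds : IsPiece s ds)
    (hc : ∀ d ∈ ds, ∃ q, IsClosedAt q d ∧ ∃ t ∈ 𝒮, IsAnchor t q) : HasTour (insert s 𝒮) := by
  obtain ⟨p, l, h1, h2, h3, h4⟩ := h
  obtain ⟨g1, g2, g3⟩ := hds
  obtain ⟨l', k1, k2, k3, k4⟩ := h1.splice_list ds fun d hd => by
    obtain ⟨q, hq, t, ht, hqt⟩ := hc d hd
    exact ⟨q, h4 t ht q hqt, hq⟩
  refine ⟨p, l', k1, ?_, ?_, ?_⟩
  · rw [k2.nodup_iff, List.nodup_append']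
    refine ⟨h2, g1, fun A hA hA' => hs ?_⟩
    rw [← ((g2 A).1 hA').2]
    exact ((h3 A).1 hA).2
  · intro A
    rw [k2.mem_iff, List.mem_append, h3, g2, Finset.mem_insert]
    tauto
  · intro t ht q hq
    rcases Finset.mem_insert.1 ht with rfl | ht
    · obtain ⟨d, hd, hqd⟩ := g3 q hq
      exact k4 d hd q hqd
    · exact k3 q (h4 t ht q hq)

/-! ### Transport along a relabelling of blocks -/

/-- Moves each block `i` onto the block `g i`. -/
def relabel (g : ℕ → ℕ) (a : ℕ) : ℕ := 3 * g (block a) + (a - 1) % 3 + 1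

theorem block_relabel (g : ℕ → ℕ) (a : ℕ) : block (relabel g a) = g (block a) := by
  unfold relabel
  generalize g (block a) = x
  unfold block
  omega

theorem relabel_injOn {g : ℕ → ℕ} {d : ℕ} (hg : Set.InjOn g (Set.Iio d)) :
    Set.InjOn (relabel g) (Set.Icc 1 (3 * d)) := by
  intro a ha b hb hab
  have h1 : block a = block b := by
    refine hg ?_ ?_ (by rw [← block_relabel g a, ← block_relabel g b, hab])
    · simp only [Set.mem_Icc, Set.mem_Iio, block] at *; omega
    · simp only [Set.mem_Icc, Set.mem_Iio, block] at *; omega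
  unfold relabel at hab
  rw [h1] at hab
  simp only [Set.mem_Icc, block] at *
  omega

theorem blocks_map_relabel (g : ℕ → ℕ) (B : Multiset ℕ) :
    blocks (B.map (relabel g)) = (blocks B).image g := by
  ext x
  simp [blocks, block_relabel]

theorem mem_of_mem_windows {l : List ℕ} {A : Multiset ℕ} (hA : A ∈ windows l) {a : ℕ}
    (ha : a ∈ A) : a ∈ l := by
  induction l with
  | nil => simp [windows] at hA
  | cons x l ih =>
    match l, ih, hA with
    | [], _, hA => simp [windows] at hA
    | [y], _, hA => simp [windows] at hA
    | y :: z :: l, ih, hA =>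
      rcases List.mem_cons.1 hA with rfl | hA
      · simp only [Multiset.insert_eq_cons, Multiset.mem_cons, Multiset.mem_singleton] at ha
        simp only [List.mem_cons]
        tauto
      · exact List.mem_cons_of_mem _ (ih hA)

theorem exists_eq_of_mem_windows {l : List ℕ} {A : Multiset ℕ} (hA : A ∈ windows l) :
    ∃ a b c, A = {a, b, c} := by
  induction l with
  | nil => simp [windows] at hA
  | cons x l ih =>
    match l, ih, hA with
    | [], _, hA => simp [windows] at hA
    | [y], _, hA => simp [windows] at hA
    | y :: z :: l, ih, hA =>
      rcases List.mem_cons.1 hA with rfl | hA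
      · exact ⟨_, _, _, rfl⟩
      · exact ih hA

/-- A piece over the first `d` blocks, in a form that can be decided. -/
def IsModelPiece (d : ℕ) (ds : List (List ℕ)) : Prop :=
  (∀ l ∈ ds, ∀ a ∈ l, a ∈ Finset.Icc 1 (3 * d)) ∧ (ds.flatMap windows).Nodup ∧
    ∀ a ∈ Finset.Icc 1 (3 * d), ∀ b ∈ Finset.Icc 1 (3 * d), ∀ c ∈ Finset.Icc 1 (3 * d),
      ({a, b, c} ∈ ds.flatMap windows ↔ blocks {a, b, c} = Finset.range d ∧
        ¬(({a, b, c} : Multiset ℕ).Nodup ∧ (blocks {a, b, c}).card = 1))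

instance (d : ℕ) (ds : List (List ℕ)) : Decidable (IsModelPiece d ds) := by
  unfold IsModelPiece
  infer_instance

/-- Relabelling is injective on the letters `1, …, 3 d` and respects blocks, so one finite check
serves every choice of `d` distinct blocks. -/
theorem IsModelPiece.relabel {d : ℕ} {ds : List (List ℕ)} (h : IsModelPiece d ds) {g : ℕ → ℕ}
    (hg : Set.InjOn g (Set.Iio d)) :
    ((ds.map (List.map (relabel g))).flatMap windows).Nodup ∧
      ∀ A, A ∈ (ds.map (List.map (relabel g))).flatMap windows ↔
        Admissible A ∧ blocks A = (Finset.range d).image g := by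
  obtain ⟨h1, h2, h3⟩ := h
  have hf := relabel_injOn hg
  set f := _root_.relabel g with hfdef
  have hinv := hf.leftInvOn_invFunOn
  set f' := Function.invFunOn f (Set.Icc 1 (3 * d))
  have hmap : ∀ B : Multiset ℕ, (∀ a ∈ B, a ∈ Finset.Icc 1 (3 * d)) →
      (B.map f).map f' = B := by
    intro B hB
    rw [Multiset.map_map]
    conv_rhs => rw [← Multiset.map_id B]
    exact Multiset.map_congr rfl fun a ha => hinv (by simpa using hB a ha)
  have hletter : ∀ B ∈ ds.flatMap windows, ∀ a ∈ B, a ∈ Finset.Icc 1 (3 * d) := by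
    intro B hB a ha
    obtain ⟨l, hl, hB⟩ := List.mem_flatMap.1 hB
    exact h1 l hl a (mem_of_mem_windows hB ha)
  have hflat : (ds.map (List.map f)).flatMap windows =
      (ds.flatMap windows).map (Multiset.map f) := by
    rw [List.flatMap_map, List.map_flatMap]
    simp only [windows_map]
  have hnodup : ∀ B : Multiset ℕ, (∀ a ∈ B, a ∈ Finset.Icc 1 (3 * d)) →
      ((B.map f).Nodup ↔ B.Nodup) := by
    intro B hB
    refine ⟨Multiset.Nodup.of_map f, fun hn => hn.map_on fun a ha b hb hab => ?_⟩
    exact hf (by simpa using hB a ha) (by simpa using hB b hb) hab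
  have hcard : ((Finset.range d).image g).card = (Finset.range d).card :=
    Finset.card_image_of_injOn (hg.mono fun x hx => by simpa using hx)
  rw [hflat]
  refine ⟨h2.map_on fun B hB C hC hBC => ?_, fun A => ?_⟩
  · rw [← hmap B (hletter B hB), hBC, hmap C (hletter C hC)]
  · rw [List.mem_map]
    constructor
    · rintro ⟨B, hB, rfl⟩
      have hBl := hletter B hB
      obtain ⟨l, hl, hBw⟩ := List.mem_flatMap.1 hB
      obtain ⟨a, b, c, rfl⟩ := exists_eq_of_mem_windows hBw
      obtain ⟨h4, h5⟩ := (h3 a (hBl a (by simp)) b (hBl b (by simp)) c (hBl c (by simp))).1 hB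
      have h6 : blocks (Multiset.map f {a, b, c}) = (Finset.range d).image g := by
        rw [hfdef, blocks_map_relabel, h4]
      refine ⟨⟨by simp, ?_, ?_⟩, h6⟩
      · intro x hx
        obtain ⟨y, -, rfl⟩ := Multiset.mem_map.1 hx
        simp [hfdef, _root_.relabel]
      · rw [hnodup _ hBl, h6, hcard, ← h4]
        exact h5
    · rintro ⟨⟨hA1, hA2, hA3⟩, hA4⟩
      have hpre : ∀ a ∈ A, ∃ e ∈ Finset.Icc 1 (3 * d), f e = a := by
        intro a ha
        have : block a ∈ blocks A := by
          rw [blocks, Multiset.mem_toFinset]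
          exact Multiset.mem_map_of_mem _ ha
        rw [hA4, Finset.mem_image] at this
        obtain ⟨i, hi, hia⟩ := this
        have ha1 := hA2 a ha
        rw [Finset.mem_range] at hi
        refine ⟨3 * i + (a - 1) % 3 + 1, by rw [Finset.mem_Icc]; omega, ?_⟩
        have hb : block (3 * i + (a - 1) % 3 + 1) = i := by unfold block; omega
        rw [hfdef, _root_.relabel, hb, hia]
        unfold block
        omega
      obtain ⟨x, y, z, rfl⟩ := Multiset.card_eq_three.1 hA1
      obtain ⟨a, ha, rfl⟩ := hpre x (by simp)
      obtain ⟨b, hb, rfl⟩ := hpre y (by simp)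
      obtain ⟨c, hc, rfl⟩ := hpre z (by simp)
      have e : ({f a, f b, f c} : Multiset ℕ) = Multiset.map f {a, b, c} := by simp
      have hBl : ∀ x ∈ ({a, b, c} : Multiset ℕ), x ∈ Finset.Icc 1 (3 * d) := by
        intro x hx
        simp only [Multiset.insert_eq_cons, Multiset.mem_cons, Multiset.mem_singleton] at hx
        rcases hx with rfl | rfl | rfl <;> assumption
      have hbl : blocks {a, b, c} = Finset.range d := by
        have hsub : ∀ i ∈ blocks {a, b, c}, i < d := by
          intro i hi
          rw [blocks, Multiset.mem_toFinset] at hi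
          obtain ⟨w, hw, rfl⟩ := Multiset.mem_map.1 hi
          have := hBl w hw
          rw [Finset.mem_Icc] at this
          unfold block; omega
        rw [e, hfdef, blocks_map_relabel] at hA4
        ext i
        constructor
        · exact fun hi => Finset.mem_range.2 (hsub i hi)
        · intro hi
          have : g i ∈ (blocks {a, b, c}).image g := by
            rw [hA4]; exact Finset.mem_image_of_mem _ hi
          obtain ⟨j, hj, hji⟩ := Finset.mem_image.1 this
          rw [← hg (hsub j hj) (Finset.mem_range.1 hi) hji]
          exact hj
      refine ⟨{a, b, c}, (h3 a ha b hb c hc).2 ⟨hbl, ?_⟩, e.symm⟩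
      rw [e, hnodup _ hBl, ← e, hA4, hcard, ← hbl] at hA3
      exact hA3

/-! ### Explicit lists for one, two and three blocks -/

/-- A closed list on one block. -/
def oneBlockList : List ℕ := [1, 1, 1, 2, 2, 2, 3, 3, 3, 1, 1]

/-- A closed list for the multisets that meet each of two blocks. -/
def twoBlockList : List ℕ :=
  [1, 1, 5, 5, 3, 6, 4, 2, 1, 6, 3, 2, 5, 6, 1, 6, 1, 4, 5, 3, 3, 6, 6, 2, 2, 4, 3, 4, 3, 1, 5, 2,
    5, 2, 4, 4, 1, 1]

/-- Closed lists for the multisets that meet each of three blocks. -/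
def threeBlockLists : List (List ℕ) :=
  [[1, 4, 7, 2, 5, 8, 3, 6, 9, 1, 4], [1, 5, 9, 2, 6, 7, 3, 4, 8, 1, 5],
    [1, 6, 8, 2, 4, 9, 3, 5, 7, 1, 6]]

theorem isModelPiece_one : IsModelPiece 1 [oneBlockList] := by decide +kernel

theorem isModelPiece_two : IsModelPiece 2 [twoBlockList] := by decide +kernel

theorem isModelPiece_three : IsModelPiece 3 threeBlockLists := by decide +kernel

theorem exists_isPiece_one (i : ℕ) :
    ∃ l, IsPiece {i} [l] ∧ IsClosedAt (3 * i + 1, 3 * i + 1) l := by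
  have h := isModelPiece_one.relabel (g := fun _ => i)
    (fun x hx y hy _ => by simp only [Set.mem_Iio] at hx hy; omega)
  rw [show (Finset.range 1).image (fun _ => i) = {i} by simp] at h
  refine ⟨oneBlockList.map (relabel fun _ => i), ⟨h.1, h.2, ?_⟩, ?_⟩
  · rintro q (⟨-, j, hj, rfl⟩ | ⟨j, k, r, hjk, -, hs, -⟩)
    · obtain rfl := Finset.mem_singleton.1 hj
      refine ⟨_, List.mem_singleton_self _, ?_⟩
      rw [consecutivePairs_map]
      exact List.mem_map.2 ⟨(1, 1), by decide, by simp [relabel]⟩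
    · have := congrArg Finset.card hs
      rw [Finset.card_singleton, Finset.card_pair hjk.ne] at this
      omega
  · have h1 : [3 * i + 1, 3 * i + 1] = [1, 1].map (relabel fun _ => i) := by simp [relabel]
    exact ⟨h1 ▸ List.IsPrefix.map _ (by decide), h1 ▸ List.IsSuffix.map _ (by decide)⟩

theorem exists_isPiece_two {i j : ℕ} (hij : i < j) :
    ∃ l, IsPiece {i, j} [l] ∧ IsClosedAt (3 * i + 1, 3 * i + 1) l := by
  set g : ℕ → ℕ := fun x => if x = 0 then i else j with hg
  have h := isModelPiece_two.relabel (g := g) (fun x hx y hy hxy => by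
    simp only [Set.mem_Iio, hg] at hx hy hxy
    split_ifs at hxy <;> omega)
  rw [show (Finset.range 2).image g = {i, j} by
    ext x; simp [Finset.range_add_one, hg]; tauto] at h
  have h1 : ∀ r < 3, relabel g (r + 1) = 3 * i + r + 1 := fun r hr => by
    have : block (r + 1) = 0 := by unfold block; omega
    simp only [relabel, this, hg, if_true]; omega
  have h2 : ∀ r < 3, relabel g (r + 4) = 3 * j + r + 1 := fun r hr => by
    have : block (r + 4) = 1 := by unfold block; omega
    simp only [relabel, this, hg, one_ne_zero, if_false]; omega
  refine ⟨twoBlockList.map (relabel g), ⟨h.1, h.2, ?_⟩, ?_⟩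
  · intro q hq
    refine ⟨_, List.mem_singleton_self _, ?_⟩
    rw [consecutivePairs_map]
    rcases hq with ⟨-, k, hk, rfl⟩ | ⟨i', j', r, hij', hr, hs, rfl⟩
    · rcases Finset.mem_insert.1 hk with rfl | hk
      · exact List.mem_map.2 ⟨(0 + 1, 0 + 1), by decide, by simp [h1 0]⟩
      · obtain rfl := Finset.mem_singleton.1 hk
        exact List.mem_map.2 ⟨(0 + 4, 0 + 4), by decide, by
          simp only [Prod.map, h2 0 (by omega)]⟩
    · have e : i' = i ∧ j' = j := by
        have a1 : i ∈ ({i', j'} : Finset ℕ) := hs ▸ by simp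
        have a2 : j ∈ ({i', j'} : Finset ℕ) := hs ▸ by simp
        simp only [Finset.mem_insert, Finset.mem_singleton] at a1 a2
        omega
      obtain ⟨rfl, rfl⟩ := e
      refine List.mem_map.2 ⟨(0 + 1, r + 4), ?_, by
        simp only [Prod.map, h1 0 (by omega), h2 r hr]⟩
      interval_cases r <;> decide
  · have e : [3 * i + 1, 3 * i + 1] = [0 + 1, 0 + 1].map (relabel g) := by
      simp only [List.map, h1 0 (by omega)]
    exact ⟨e ▸ List.IsPrefix.map _ (by decide), e ▸ List.IsSuffix.map _ (by decide)⟩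

theorem exists_isPiece_three {i j k : ℕ} (hij : i < j) (hjk : j < k) :
    ∃ ds, IsPiece {i, j, k} ds ∧
      ∀ d ∈ ds, ∃ q, IsClosedAt q d ∧ IsAnchor {i, j} q := by
  set g : ℕ → ℕ := fun x => if x = 0 then i else if x = 1 then j else k with hg
  have h := isModelPiece_three.relabel (g := g) (fun x hx y hy hxy => by
    simp only [Set.mem_Iio, hg] at hx hy hxy
    split_ifs at hxy <;> omega)
  rw [show (Finset.range 3).image g = {i, j, k} by
    ext x; simp [Finset.range_add_one, hg]; tauto] at h
  have h1 : relabel g 1 = 3 * i + 1 := by simp [relabel, block, hg]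
  have h2 : ∀ r < 3, relabel g (r + 4) = 3 * j + r + 1 := fun r hr => by
    have : block (r + 4) = 1 := by unfold block; omega
    simp only [relabel, this, hg, one_ne_zero, if_false, if_true]; omega
  -- The model lists are closed at `(1, 4)`, `(1, 5)` and `(1, 6)`, which become the mixed anchors
  -- of `{i, j}`.
  have key : ∀ d ∈ threeBlockLists, ∃ r < 3, [1, r + 4] <+: d ∧ [1, r + 4] <:+ d := by decide
  refine ⟨threeBlockLists.map (List.map (relabel g)), ⟨h.1, h.2, ?_⟩, ?_⟩
  · have hc : ({i, j, k} : Finset ℕ).card = 3 := Finset.card_eq_three.2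
      ⟨i, j, k, hij.ne, (hij.trans hjk).ne, hjk.ne, rfl⟩
    -- A set of three blocks has no anchors.
    rintro q (⟨hc', -⟩ | ⟨i', j', r, hij', -, hs, -⟩)
    · omega
    · rw [hs, Finset.card_pair hij'.ne] at hc
      omega
  · intro d hd
    obtain ⟨d', hd', rfl⟩ := List.mem_map.1 hd
    obtain ⟨r, hr, hp, hs⟩ := key d' hd'
    refine ⟨(3 * i + 1, 3 * j + r + 1), ?_, Or.inr ⟨i, j, r, hij, hr, rfl, rfl⟩⟩
    have e : [3 * i + 1, 3 * j + r + 1] = [1, r + 4].map (relabel g) := by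
      simp only [List.map, h1, h2 r hr]
    exact ⟨e ▸ hp.map _, e ▸ hs.map _⟩

/-! ### Joining all classes -/

theorem hasTour_singleton_zero : HasTour {{0}} := by
  obtain ⟨l, ⟨h1, h2, h3⟩, h4⟩ := exists_isPiece_one 0
  refine ⟨_, l, h4, by simpa using h1, fun A => by simpa using h2 A, ?_⟩
  intro s hs q hq
  obtain rfl := Finset.mem_singleton.1 hs
  simpa using h3 q hq

/-- In a largest family that contains `{0}` and has a tour, any class attachable at an anchor of a
member is already a member. -/
theorem hasTour_filter_powerset {n : ℕ} (hn : 0 < n) :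
    HasTour ((Finset.range n).powerset.filter fun s => 0 < s.card ∧ s.card ≤ 3) := by
  classical
  set U := (Finset.range n).powerset.filter fun s => 0 < s.card ∧ s.card ≤ 3 with hU
  have memU : ∀ s, s ∈ U ↔ s ⊆ Finset.range n ∧ 0 < s.card ∧ s.card ≤ 3 := by simp [hU]
  have h0 : {{0}} ∈ (U.powerset.filter fun 𝒮 => HasTour 𝒮 ∧ {0} ∈ 𝒮) := by
    simp [hasTour_singleton_zero, memU, hn]
  obtain ⟨𝒮, h𝒮, hmax⟩ := Finset.exists_max_image _ Finset.card ⟨_, h0⟩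
  simp only [Finset.mem_filter, Finset.mem_powerset] at h𝒮 hmax
  obtain ⟨hsub, htour, hz⟩ := h𝒮
  have closure : ∀ s ∈ U, ∀ ds, IsPiece s ds →
      (∀ d ∈ ds, ∃ q, IsClosedAt q d ∧ ∃ t ∈ 𝒮, IsAnchor t q) → s ∈ 𝒮 := by
    intro s hsU ds hds hc
    by_contra hs
    have := hmax (insert s 𝒮) ⟨Finset.insert_subset hsU hsub, htour.insert hs hds hc,
      Finset.mem_insert_of_mem hz⟩
    rw [Finset.card_insert_of_notMem hs] at this
    omega
  have pairs_of_left : ∀ i j, i < j → j < n → {i} ∈ 𝒮 → {i, j} ∈ 𝒮 := by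
    intro i j hij hj hi
    obtain ⟨l, hl, hl'⟩ := exists_isPiece_two hij
    refine closure _ ?_ [l] hl ?_
    · rw [memU, Finset.card_pair hij.ne]
      refine ⟨?_, by omega, by omega⟩
      intro x hx
      simp only [Finset.mem_insert, Finset.mem_singleton] at hx
      rw [Finset.mem_range]; omega
    · intro d hd
      obtain rfl := List.mem_singleton.1 hd
      exact ⟨_, hl', {i}, hi, Or.inl ⟨by simp, i, by simp, rfl⟩⟩
  have singles : ∀ j < n, {j} ∈ 𝒮 := by
    intro j hj
    rcases Nat.eq_zero_or_pos j with rfl | hj0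
    · exact hz
    obtain ⟨l, hl, hl'⟩ := exists_isPiece_one j
    refine closure _ (by rw [memU]; simp [hj]) [l] hl ?_
    intro d hd
    obtain rfl := List.mem_singleton.1 hd
    exact ⟨_, hl', {0, j}, pairs_of_left 0 j hj0 hj hz,
      Or.inl ⟨Finset.card_le_two, j, by simp, rfl⟩⟩
  have hUS : U ⊆ 𝒮 := by
    intro s hs
    have hs' := (memU s).1 hs
    have hlt : ∀ x ∈ s, x < n := fun x hx => Finset.mem_range.1 (hs'.1 hx)
    obtain hc | hc | hc : s.card = 1 ∨ s.card = 2 ∨ s.card = 3 := by omega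
    · obtain ⟨i, rfl⟩ := Finset.card_eq_one.1 hc
      exact singles i (hlt i (by simp))
    · obtain ⟨i, j, hij, rfl⟩ := Finset.card_eq_two.1 hc
      rcases hij.lt_or_gt with h | h
      · exact pairs_of_left i j h (hlt j (by simp)) (singles i (hlt i (by simp)))
      · rw [Finset.pair_comm]
        exact pairs_of_left j i h (hlt i (by simp)) (singles j (hlt j (by simp)))
    · obtain ⟨i, j, k, hij, hjk, rfl⟩ : ∃ i j k, i < j ∧ j < k ∧ s = {i, j, k} := by
        set e := s.orderEmbOfFin hc
        refine ⟨e 0, e 1, e 2, e.strictMono (by decide), e.strictMono (by decide), ?_⟩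
        have : s = Finset.univ.image e := by
          rw [← Finset.coe_inj]; simp [e]
        conv_lhs => rw [this]
        ext x
        simp [Fin.exists_fin_succ, eq_comm]
      obtain ⟨ds, hds, hds'⟩ := exists_isPiece_three hij hjk
      refine closure _ hs ds hds fun d hd => ?_
      obtain ⟨q, hq, hq'⟩ := hds' d hd
      exact ⟨q, hq, {i, j}, pairs_of_left i j hij (hlt j (by simp)) (singles i (hlt i (by simp))),
        hq'⟩
  rwa [Finset.Subset.antisymm hUS hsub]

/-! ### Excluded multisets and counting -/

/-- Three distinct letters of one block exhaust it. -/
theorem nodup_and_card_blocks_eq_one_iff {A : Multiset ℕ} (hA : A.card = 3)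
    (hpos : ∀ a ∈ A, 1 ≤ a) :
    (A.Nodup ∧ (blocks A).card = 1) ↔ ∃ i, A = {3 * i + 1, 3 * i + 2, 3 * i + 3} := by
  constructor
  · rintro ⟨hn, hc⟩
    obtain ⟨i, hi⟩ := Finset.card_eq_one.1 hc
    refine ⟨i, Multiset.eq_of_le_of_card_le ?_ (by simp [hA])⟩
    rw [Multiset.le_iff_subset hn]
    intro a ha
    have h1 := hpos a ha
    have h2 : block a ∈ blocks A := by
      rw [blocks, Multiset.mem_toFinset]; exact Multiset.mem_map_of_mem _ ha
    rw [hi, Finset.mem_singleton, block] at h2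
    simp only [Multiset.insert_eq_cons, Multiset.mem_cons, Multiset.mem_singleton]
    omega
  · rintro ⟨i, rfl⟩
    refine ⟨by simp, Finset.card_eq_one.2 ⟨i, ?_⟩⟩
    have h1 : block (3 * i + 1) = i := by unfold block; omega
    have h2 : block (3 * i + 2) = i := by unfold block; omega
    have h3 : block (3 * i + 3) = i := by unfold block; omega
    ext x
    simp [blocks, h1, h2, h3]

theorem blocks_mem_iff {A : Multiset ℕ} (hA : A.card = 3) (hpos : ∀ a ∈ A, 1 ≤ a) (n : ℕ) :
    blocks A ∈ ((Finset.range n).powerset.filter fun s => 0 < s.card ∧ s.card ≤ 3) ↔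
      ∀ a ∈ A, a ∈ Finset.Icc 1 (3 * n) := by
  have hc : 0 < (blocks A).card ∧ (blocks A).card ≤ 3 := by
    constructor
    · obtain ⟨x, y, z, rfl⟩ := Multiset.card_eq_three.1 hA
      exact Finset.card_pos.2 ⟨block x, by simp [blocks]⟩
    · refine (Multiset.toFinset_card_le _).trans ?_
      rw [Multiset.card_map, hA]
  rw [Finset.mem_filter, Finset.mem_powerset, and_iff_left hc]
  simp only [Finset.subset_iff, blocks, Multiset.mem_toFinset, Multiset.mem_map,
    forall_exists_index, and_imp, forall_apply_eq_imp_iff₂, Finset.mem_range, Finset.mem_Icc]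
  refine forall₂_congr fun a ha => ?_
  have := hpos a ha
  unfold block
  omega

/-- The three-element multisets with elements in `{1, …, k}`. -/
def threeMultisets (k : ℕ) : Finset (Multiset ℕ) :=
  (Finset.univ : Finset (Sym (Finset.Icc 1 k) 3)).image fun s => s.1.map Subtype.val

theorem mem_threeMultisets {k : ℕ} {A : Multiset ℕ} :
    A ∈ threeMultisets k ↔ A.card = 3 ∧ ∀ a ∈ A, a ∈ Finset.Icc 1 k := by
  rw [threeMultisets, Finset.mem_image]
  constructor
  · rintro ⟨s, -, rfl⟩
    refine ⟨by rw [Multiset.card_map]; exact s.2, fun a ha => ?_⟩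
    obtain ⟨b, -, rfl⟩ := Multiset.mem_map.1 ha
    exact b.2
  · rintro ⟨h1, h2⟩
    lift A to Multiset (Finset.Icc 1 k) using h2
    exact ⟨⟨A, by simpa using h1⟩, Finset.mem_univ _, rfl⟩

theorem card_threeMultisets (k : ℕ) : (threeMultisets k).card = (k + 2).choose 3 := by
  rw [threeMultisets, Finset.card_image_of_injective, Finset.card_univ, Sym.card_sym_eq_choose]
  · simp
  · intro s t hst
    exact Subtype.ext (Multiset.map_injective Subtype.val_injective hst)

/-! ### From a closed list to a cyclic sequence -/

/-- The last two entries repeat the first two. Length at least 4 keeps the indices 0 and 1 below the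
modulus. -/
theorem IsClosedAt.getElem_mod {p : ℕ × ℕ} {l : List ℕ} (h : IsClosedAt p l)
    (hl : 4 ≤ l.length) {i : ℕ} (hi : i < l.length) :
    l[i] = l[i % (l.length - 2)]'((Nat.mod_le _ _).trans_lt hi) := by
  obtain ⟨⟨u, hu⟩, ⟨v, hv⟩⟩ := h
  have hlen : v.length + 2 = l.length := by rw [← hv]; simp
  have hvl : l.length - 2 = v.length := by omega
  rcases lt_or_ge i v.length with h1 | h1
  · simp only [hvl, Nat.mod_eq_of_lt h1]
  · have h2 : i % (l.length - 2) = i - v.length := by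
      rw [hvl, Nat.mod_eq_sub_mod h1, Nat.mod_eq_of_lt (by omega)]
    simp only [h2]
    have e1 : ∀ j, (hj : j < 2) → l[j]'(by omega) = [p.1, p.2][j] := by
      intro j hj
      simp only [← hu]
      exact List.getElem_append_left _
    have e2 : l[i] = [p.1, p.2][i - v.length]'(by simp; omega) := by
      simp only [← hv]
      exact List.getElem_append_right h1
    rw [e2, e1 _ (by omega)]

theorem mainTheorem3 (k : ℕ) (hk : 0 < k) (h3 : 3 ∣ k) :
    ∃ (M : ℕ) (S : Fin M → ℕ),
      (M : ℤ) = ((k + 2).choose 3 : ℤ) - (k : ℤ) / 3 ∧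
      (∀ t : Fin M, S t ∈ Finset.Icc 1 k) ∧
      IsCyclicDistinguishable 3 S ∧
      ∀ A : Multiset ℕ, A.card = 3 → (∀ a ∈ A, a ∈ Finset.Icc 1 k) →
        ((∀ t : Fin M, cyclicMultiset 3 S t ≠ A) ↔
          ∃ i : ℕ, i < k / 3 ∧ A = {3 * i + 1, 3 * i + 2, 3 * i + 3}) := by
  classical
  obtain ⟨n, rfl⟩ := h3
  have hn : 0 < n := by omega
  obtain ⟨p, l, hcl, hnd, hmem, -⟩ := hasTour_filter_powerset hn
  set E := (Finset.range n).image fun i => ({3 * i + 1, 3 * i + 2, 3 * i + 3} : Multiset ℕ)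
    with hE
  have hEmem : ∀ A : Multiset ℕ, (∀ a ∈ A, a ∈ Finset.Icc 1 (3 * n)) →
      ((∃ i, A = {3 * i + 1, 3 * i + 2, 3 * i + 3}) ↔
        ∃ i, i < n ∧ A = {3 * i + 1, 3 * i + 2, 3 * i + 3}) := by
    refine fun A hA => ⟨?_, fun ⟨i, _, h⟩ => ⟨i, h⟩⟩
    rintro ⟨i, rfl⟩
    have := hA (3 * i + 1) (by simp)
    rw [Finset.mem_Icc] at this
    exact ⟨i, by omega, rfl⟩
  have hwin : ∀ A, A ∈ windows l ↔ (A.card = 3 ∧ ∀ a ∈ A, a ∈ Finset.Icc 1 (3 * n)) ∧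
      ¬∃ i, i < n ∧ A = {3 * i + 1, 3 * i + 2, 3 * i + 3} := by
    intro A
    rw [hmem]
    constructor
    · rintro ⟨⟨h1, h2, h4⟩, h5⟩
      rw [blocks_mem_iff h1 h2] at h5
      rw [nodup_and_card_blocks_eq_one_iff h1 h2, hEmem A h5] at h4
      exact ⟨⟨h1, h5⟩, h4⟩
    · rintro ⟨⟨h1, h2⟩, h4⟩
      have h5 : ∀ a ∈ A, 1 ≤ a := fun a ha => (Finset.mem_Icc.1 (h2 a ha)).1
      rw [← hEmem A h2, ← nodup_and_card_blocks_eq_one_iff h1 h5] at h4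
      exact ⟨⟨h1, h5, h4⟩, (blocks_mem_iff h1 h5 n).2 h2⟩
  have hcard : (windows l).length + n = (3 * n + 2).choose 3 := by
    have hsub : E ⊆ threeMultisets (3 * n) := by
      intro A hA
      obtain ⟨i, hi, rfl⟩ := Finset.mem_image.1 hA
      rw [Finset.mem_range] at hi
      refine mem_threeMultisets.2 ⟨by simp, fun a ha => ?_⟩
      simp only [Multiset.insert_eq_cons, Multiset.mem_cons, Multiset.mem_singleton] at ha
      rw [Finset.mem_Icc]; omega
    have hEc : E.card = n := by
      rw [hE, Finset.card_image_of_injective, Finset.card_range]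
      intro i j hij
      -- The sum `9 i + 6` recovers `i`.
      have := congrArg Multiset.sum hij
      simp at this
      omega
    have : (windows l).toFinset = threeMultisets (3 * n) \ E := by
      ext A
      rw [List.mem_toFinset, hwin, Finset.mem_sdiff, mem_threeMultisets, hE, Finset.mem_image]
      simp only [Finset.mem_range, eq_comm]
    rw [← List.toFinset_card_of_nodup hnd, this, ← card_threeMultisets,
      Finset.card_sdiff_of_subset hsub, hEc]
    have := Finset.card_le_card hsub
    omega
  rw [windows_length] at hcard
  -- Two different windows, `{1, 1, 1}` and `{1, 1, 2}`, force four entries; their sums 3 and 4 are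
  -- too small for a block.
  have hlen : 4 ≤ l.length := by
    have hw : ∀ a ∈ Finset.Icc 1 2, ({1, 1, a} : Multiset ℕ) ∈ windows l := by
      intro a ha
      rw [Finset.mem_Icc] at ha
      refine (hwin _).2 ⟨⟨by simp, fun b hb => ?_⟩, ?_⟩
      · simp only [Multiset.insert_eq_cons, Multiset.mem_cons, Multiset.mem_singleton] at hb
        rw [Finset.mem_Icc]; omega
      · rintro ⟨i, -, hi⟩
        have := congrArg Multiset.sum hi
        simp only [Multiset.insert_eq_cons, Multiset.sum_cons, Multiset.sum_singleton] at this
        omega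
    obtain ⟨s, hs, hs'⟩ := List.mem_iff_getElem.1 (hw 1 (by simp))
    obtain ⟨t, ht, ht'⟩ := List.mem_iff_getElem.1 (hw 2 (by simp))
    have hst : s ≠ t := by
      rintro rfl
      exact absurd (hs'.symm.trans ht') (by decide)
    rw [windows_length] at hs ht
    omega
  set S : Fin (l.length - 2) → ℕ := fun t => l[(t : ℕ)] with hS
  have hcm : ∀ t : Fin (l.length - 2), cyclicMultiset 3 S t =
      (windows l)[(t : ℕ)]'(by rw [windows_length]; exact t.2) := by
    intro t
    have ht := t.2
    rw [windows_getElem l t (by omega), hcl.getElem_mod hlen (i := t) (by omega),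
      hcl.getElem_mod hlen (i := t + 1) (by omega), hcl.getElem_mod hlen (i := t + 2) (by omega)]
    rfl
  have hex : ∀ A, A ∈ windows l ↔ ∃ t, cyclicMultiset 3 S t = A := by
    intro A
    rw [List.mem_iff_getElem]
    constructor
    · rintro ⟨t, ht, rfl⟩
      rw [windows_length] at ht
      exact ⟨⟨t, ht⟩, hcm _⟩
    · rintro ⟨t, rfl⟩
      exact ⟨t, by rw [windows_length]; exact t.2, (hcm t).symm⟩
  refine ⟨l.length - 2, S, ?_, ?_, ?_, ?_⟩
  · rw [← hcard]; push_cast; omega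
  · intro t
    refine ((hwin _).1 ((hex _).2 ⟨t, rfl⟩)).1.2 (S t) ?_
    rw [hcm, windows_getElem l t (by have := t.2; omega)]
    simp [hS]
  · intro t t' htt
    rw [hcm, hcm, hnd.getElem_inj_iff] at htt
    exact Fin.ext htt
  · intro A h1 h2
    rw [Nat.mul_div_cancel_left n (by norm_num)]
    have := (hwin A).not
    rw [hex, not_exists] at this
    rw [show (∀ t, cyclicMultiset 3 S t ≠ A) ↔ _ from this, and_iff_right ⟨h1, h2⟩, not_not]
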